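/- Let $X$ be a locally noetherian noncommutative space, that is, a Grothendieck category $\operatorname{Mod}X$ with a small set of noetherian generators; its objects are called $X$-modules. A full subcategory $Z$ of $\operatorname{Mod}X$ is *weakly closed* if it is closed under isomorphisms, subobjects, quotients and (small) direct sums. For an $X$-module $M$, $\sigma[M]$ denotes the smallest weakly closed subcategory containing $M$. For weakly closed $Z$, $\operatorname{Mod}_ZX$ denotes the full subcategory of those $X$-modules $N$ that have an exhaustive ascending filtration $0=N_0\le N_1\le N_2\le\cdots$, $\sum_n N_n=N$, with $N_{n+1}/N_n\in Z$ for all $n$. Let $\operatorname{Inj}(X)$ be the collection of isomorphism classes $x=[E(x)]$ of indecomposable injective $X$-modules, with the *weak Zariski topology*: the sets $V(Z)=\{x : E(x)\text{ has a nonzero submodule in } Z\}$, for $Z$ weakly closed, form a basis of the closed sets. $X$ is *topologically irreducible* if $\operatorname{Inj}(X)$ is an irreducible topological space. Let $\dim$ be a dimension function on $X$, that is, a function from $X$-modules to ordinals together with $-1$ such that (a) $\dim M=-1$ if and only if $M=0$; (b) $\dim N=\max\{\dim M,\dim K\}$ for every short exact sequence $0\to M\to N\to K\to 0$; (c) $\dim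 N=\sup\{\dim N' : N'\le N \text{ noetherian}\}$; (d) for every noetherian $M$ and every chain of submodules $M=M_0\supsetneq M_1\supsetneq M_2\supsetneq\cdots$ one has $\dim M_i/M_{i+1}<\dim M$ for all but finitely many $i$. Put $\dim X=\sup\{\dim M : M\in\operatorname{Mod}X\}$. For an ordinal $\alpha$, an $X$-module $M$ is *$\alpha$-critical* if $\dim M=\alpha$ and $\dim M/N<\alpha$ for every nonzero submodule $N\le M$. An indecomposable injective $X$-module has *critical dimension* $\alpha$ if it has an $\alpha$-critical submodule. **Theorem.** Suppose that $X$ is topologically irreducible and that $\dim X=\alpha$ for an ordinal $\alpha\ge 0$; if $\alpha$ is a limit ordinal, suppose in addition that some noetherian $X$-module has dimension $\alpha$. Then there is an $\alpha$-critical $X$-module $M$ such that $\operatorname{Mod}X=\operatorname{Mod}_{\sigma[M]}X$. Moreover, $X$ has, up to isomorphism, exactly one indecomposable injective module of critical dimension $\alpha$. -/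

import Mathlib

open CategoryTheory CategoryTheory.Limits

universe t v u

namespace NCSpace

section

variable {C : Type u} [Category.{v} C]

/-- A weakly closed subspace: a full subcategory closed under submodules, quotients
(in particular under isomorphisms) and direct sums. -/
structure IsWeaklyClosed (Z : ObjectProperty C) : Prop where
  subobjects : Z.IsClosedUnderSubobjects
  quotients : Z.IsClosedUnderQuotients
  directSums : ∀ I : Type v, Z.IsClosedUnderColimitsOfShape (Discrete I)

/-- `σ[M]`: the smallest weakly closed subspace containing `M`. -/
def sigma (M : C) : ObjectProperty C :=
  fun N => ∀ Z : ObjectProperty C, IsWeaklyClosed Z → Z M → Z N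

lemma sigma_self (M : C) : sigma M M := fun _ _ h => h

lemma sigma_isWeaklyClosed (M : C) : IsWeaklyClosed (sigma M) where
  subobjects := ⟨fun f _ hY Z hZ hM =>
    haveI := hZ.subobjects; Z.prop_of_mono f (hY Z hZ hM)⟩
  quotients := ⟨fun f _ hX Z hZ hM =>
    haveI := hZ.quotients; Z.prop_of_epi f (hX Z hZ hM)⟩
  directSums := fun I => ⟨by
    rintro N ⟨h⟩ Z hZ hM
    have := hZ.directSums I
    exact Z.prop_of_isColimit h.isColimit (fun j => h.prop_diag_obj j Z hZ hM)⟩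

end

section

variable (C : Type u) [Category.{v} C] [Abelian C]

/-- A Grothendieck category is locally noetherian if it has a (small) set of noetherian
generators. -/
def IsLocallyNoetherian : Prop :=
  ∃ (ι : Type v) (G : ι → C),
    (∀ i, IsNoetherianObject (G i)) ∧ (ObjectProperty.ofObj G).IsSeparating

/-- The quotient `B / A` of two submodules `A ≤ B` of a module `M`. -/
noncomputable def subquot {C : Type u} [Category.{v} C] [Abelian C] {M : C}
    (A B : Subobject M) (h : A ≤ B) : C :=
  cokernel (Subobject.ofLE A B h)

/-- An (exact, finitely partitive) dimension function, with values in the ordinals together with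
`-1`, which is written `⊥`. -/
structure DimensionFunction where
  /-- the dimension of a module -/
  dim : C → WithBot Ordinal.{t}
  /-- only the zero module has dimension `-1` -/
  dim_eq_bot_iff : ∀ M : C, dim M = ⊥ ↔ IsZero M
  /-- exactness -/
  dim_shortExact : ∀ S : ShortComplex C, S.ShortExact → dim S.X₂ = max (dim S.X₁) (dim S.X₃)
  /-- the dimension of a module is the supremum of the dimensions of its noetherian submodules -/
  dim_isLUB : ∀ N : C,
    IsLUB {d | ∃ N' : Subobject N, IsNoetherianObject (N' : C) ∧ dim (N' : C) = d} (dim N)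
  /-- for a chain `M = M₀ ⊃ M₁ ⊃ ⋯` in a noetherian module `M`, all but finitely many of the
  factors have dimension less than `dim M` -/
  finitelyPartitive : ∀ M : C, IsNoetherianObject M → ∀ (F : ℕ → Subobject M)
    (hF : StrictAnti F), F 0 = ⊤ →
      {i | ¬ dim (subquot (F (i + 1)) (F i) (hF (Nat.lt_succ_self i)).le) < dim M}.Finite

/-- The isomorphism relation on indecomposable injective modules. -/
def injSetoid : Setoid {E : C // Injective E ∧ Indecomposable E} where
  r E E' := Nonempty ((E : C) ≅ (E' : C))
  iseqv :=
    { refl := fun _ => ⟨Iso.refl _⟩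
      symm := fun ⟨e⟩ => ⟨e.symm⟩
      trans := fun ⟨e⟩ ⟨e'⟩ => ⟨e.trans e'⟩ }

/-- The injective spectrum `Inj(X)`: isomorphism classes of indecomposable injectives. -/
def Inj : Type u := Quotient (injSetoid C)

end

section

variable {C : Type u} [Category.{v} C] [Abelian C]

/-- The chosen representative `E(x)` of a point `x` of the injective spectrum. -/
noncomputable def Inj.E (x : Inj C) : C := (Quotient.out x).1

/-- The saturation `Mod_Z X` of a subspace `Z`: the modules `M` supported at `Z`, that is, those
with an exhaustive ascending filtration `0 = M₀ ≤ M₁ ≤ ⋯` whose successive quotients are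
in `Z`. -/
def saturation (Z : ObjectProperty C) : ObjectProperty C :=
  fun M => ∃ (F : ℕ → Subobject M) (hF : Monotone F), F 0 = ⊥ ∧ IsLUB (Set.range F) ⊤ ∧
    ∀ n, Z (subquot (F n) (F (n + 1)) (hF (Nat.le_succ n)))

/-- `V(Z)`: the points `x` such that the largest submodule of `E(x)` lying in `Z` is nonzero,
that is, such that `E(x)` has a nonzero submodule in `Z`. -/
def V (Z : ObjectProperty C) : Set (Inj C) :=
  {x | ∃ N : Subobject x.E, N ≠ ⊥ ∧ Z (N : C)}

/-- The weak Zariski topology, in which the sets `V(Z)` with `Z` weakly closed form a basis of the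
closed sets. -/
instance weakZariski : TopologicalSpace (Inj C) :=
  TopologicalSpace.generateFrom {U | ∃ Z : ObjectProperty C, IsWeaklyClosed Z ∧ U = (V Z)ᶜ}

variable (C) in
/-- `X` is topologically irreducible if `Inj(X)` is irreducible in the weak Zariski topology. -/
def TopologicallyIrreducible : Prop := IrreducibleSpace (Inj C)

/-- `dim X = α`, where `dim X = sup {dim M}` over all modules `M`. -/
def DimensionFunction.SpaceDimEq (δ : DimensionFunction.{t} C) (α : Ordinal.{t}) : Prop :=
  IsLUB (Set.range δ.dim) (α : WithBot Ordinal.{t})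

/-- `M` is `α`-critical: `dim M = α` and all proper quotients of `M` have dimension less
than `α`. -/
def DimensionFunction.IsCritical (δ : DimensionFunction.{t} C) (α : Ordinal.{t}) (M : C) : Prop :=
  δ.dim M = α ∧ ∀ N : Subobject M, N ≠ ⊥ → δ.dim (cokernel N.arrow) < α

/-- `Inj_α(X)`: the points `x` such that `E(x)` has critical dimension `α`, that is, such that
`E(x)` has an `α`-critical submodule. -/
def DimensionFunction.InjDim (δ : DimensionFunction.{t} C) (α : Ordinal.{t}) : Set (Inj C) :=
  {x | ∃ N : Subobject x.E, δ.IsCritical α (N : C)}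

end

end NCSpace

/-!
A point of the injective spectrum whose injective contains an `α`-critical object, `α` being the
dimension of the whole category, is an open point (`isOpen_singleton_of_isCritical`); both
assertions follow from this and irreducibility, since any two nonempty open sets meet.

For an injective object `F`, the objects `N` with `Hom(N, F) = 0` form a weakly closed subcategory
`Z`. Take `F = E(x)` with an `α`-critical subobject. The point `x` is not in `V(Z)`. Conversely, let
`y` be outside `V(Z)`, and let `L` be a critical subobject of `E(y)`; every nonzero object has one,
by `DimensionFunction.exists_isCritical_mono`, which is where the finiteness condition on descending
chains enters. There is a nonzero morphism `L ⟶ E(x)`. Nonzero subobjects of `E(x)` have dimension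
`α`, whereas the image of a morphism out of `L` that is not a monomorphism has dimension less than
that of `L`, hence less than `α`. So `L` embeds into both `E(x)` and `E(y)`. As these are
indecomposable, both are injective hulls of `L`, and `x = y`. Hence `{x}` is the complement
of `V(Z)`.

Two points of critical dimension `α` are two open points, so they coincide. If `M` is `α`-critical,
with hull `E(x)`, the closed set `V(σ[M])` contains the dense point `x`, so it is everything. As
every nonzero object `N` contains a critical object, which is contained in some `E(y)` essentially,
`N` has a nonzero subobject in `σ[M]`. Finally `IsWeaklyClosed.saturation_of_exists` shows that the
iterated largest subobjects in `σ[M]` of the successive quotients of `N` exhaust `N`.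

Injective hulls (`exists_hull`) are constructed inside an injective object by applying Zorn's lemma
twice, the upper bounds for chains being supplied by exactness of filtered colimits
(`mono_of_directed_sSup`).
-/

namespace NCSpace

/-! ### Essential monomorphisms -/

section Essential

variable {C : Type u} [Category.{v} C]

/-- A monomorphism `i : L ⟶ F` is essential if every morphism out of `F` whose restriction to `L`
is a monomorphism is itself a monomorphism. In an abelian category this says that every nonzero
subobject of `F` meets `L`; see `IsEssential.exists_common`. -/
structure IsEssential {L F : C} (i : L ⟶ F) : Prop where
  mono : Mono i
  mono_of_mono_comp : ∀ {Y : C} (g : F ⟶ Y), Mono (i ≫ g) → Mono g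

lemma IsEssential.comp {L F G : C} {i : L ⟶ F} {j : F ⟶ G} (hi : IsEssential i)
    (hj : IsEssential j) : IsEssential (i ≫ j) where
  mono := haveI := hi.mono; haveI := hj.mono; mono_comp i j
  mono_of_mono_comp g hg :=
    hj.mono_of_mono_comp g (hi.mono_of_mono_comp (j ≫ g) (by simpa using hg))

lemma isEssential_of_isIso {L F : C} (i : L ⟶ F) [IsIso i] : IsEssential i where
  mono := inferInstance
  mono_of_mono_comp g _ := by
    have : g = inv i ≫ i ≫ g := by simp
    rw [this]
    exact mono_comp _ _

variable [Abelian C]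

lemma isZero_of_eq_zero_of_epi {A B : C} (f : A ⟶ B) [Epi f] (h : f = 0) : IsZero B := by
  rw [IsZero.iff_id_eq_zero, ← cancel_epi f]
  simp [h]

lemma isZero_of_eq_zero_of_mono {A B : C} (f : A ⟶ B) [Mono f] (h : f = 0) : IsZero A := by
  rw [IsZero.iff_id_eq_zero, ← cancel_mono f]
  simp [h]

lemma not_isZero_kernel_of_not_mono {A B : C} (f : A ⟶ B) (h : ¬ Mono f) :
    ¬ IsZero (kernel f) := fun hz =>
  h (Preadditive.mono_of_kernel_zero (hz.eq_of_src _ _))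

lemma not_isZero_image_of_ne_zero {A B : C} (f : A ⟶ B) (h : f ≠ 0) :
    ¬ IsZero (image f) := fun hz =>
  h (by rw [← image.fac f, hz.eq_of_tgt (factorThruImage f) 0, zero_comp])

/-- A nonzero subobject of an essential extension of `L` has a nonzero subobject in common
with `L`. -/
lemma IsEssential.exists_common {L F A : C} {i : L ⟶ F} (hi : IsEssential i) (a : A ⟶ F) [Mono a]
    (hA : ¬ IsZero A) :
    ∃ (B : C) (p : B ⟶ L) (q : B ⟶ A), Mono p ∧ Mono q ∧ ¬ IsZero B ∧ p ≫ i = q ≫ a := by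
  have hmono := hi.mono
  have h : ¬ Mono (i ≫ cokernel.π a) := fun h => by
    have := hi.mono_of_mono_comp _ h
    refine hA (isZero_of_eq_zero_of_mono a ?_)
    rw [← cancel_mono (cokernel.π a)]
    simp
  have w : (kernel.ι (i ≫ cokernel.π a) ≫ i) ≫ cokernel.π a = 0 := by
    rw [Category.assoc, kernel.condition]
  refine ⟨kernel (i ≫ cokernel.π a), kernel.ι _, Abelian.monoLift a _ w, inferInstance, ?_,
    not_isZero_kernel_of_not_mono _ h, (Abelian.monoLift_comp a _ w).symm⟩
  have : Mono (Abelian.monoLift a _ w ≫ a) := by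
    rw [Abelian.monoLift_comp a _ w]
    infer_instance
  exact mono_of_mono _ a

/-- A split nonzero subobject of an indecomposable object is everything. -/
lemma isIso_of_retraction {F I : C} (hI : Indecomposable I) (hF : ¬ IsZero F) (e : F ⟶ I)
    (r : I ⟶ F) (h : e ≫ r = 𝟙 F) : IsIso e := by
  have : Mono e := mono_of_mono_fac h
  let S := ShortComplex.mk e (cokernel.π e) (cokernel.condition e)
  have hS : S.Exact := ShortComplex.exact_cokernel e
  let sp : S.Splitting := ShortComplex.Splitting.ofExactOfRetraction S hS r h
    (inferInstanceAs (Epi (cokernel.π e)))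
  have hz : IsZero (cokernel e) := (hI.2 _ _ sp.isoBinaryBiproduct).resolve_left hF
  have : Epi e := Preadditive.epi_of_cokernel_zero (hz.eq_of_tgt _ _)
  exact isIso_of_mono_of_epi e

/-- Injective objects containing a common nonzero subobject essentially, one of them
indecomposable, are isomorphic. -/
lemma nonempty_iso_of_isEssential {L F E : C} [Injective F] [Injective E] (hE : Indecomposable E)
    {i : L ⟶ F} (hi : IsEssential i) (j : L ⟶ E) [Mono j] (hL : ¬ IsZero L) :
    Nonempty (F ≅ E) := by
  have := hi.mono
  have hg : i ≫ Injective.factorThru j i = j := Injective.comp_factorThru j i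
  set g := Injective.factorThru j i
  have : Mono g := hi.mono_of_mono_comp g (by rw [hg]; infer_instance)
  have hF : ¬ IsZero F := fun hz => hL (hz.of_mono i)
  have := isIso_of_retraction hE hF g (Injective.factorThru (𝟙 F) g)
    (Injective.comp_factorThru _ _)
  exact ⟨asIso g⟩

end Essential

/-! ### Injective hulls -/

section Hull

variable {C : Type u} [Category.{v} C] [Abelian C] [IsGrothendieckAbelian.{v} C]

attribute [local instance] IsFiltered.isConnected

/-- In a Grothendieck category, a morphism out of a directed union of subobjects is a monomorphism
as soon as its restrictions to the members of the union are. -/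
lemma mono_of_directed_sSup {X Y : C} (s : Set (Subobject X)) (hne : s.Nonempty)
    (hs : DirectedOn (· ≤ ·) s) (g : ((sSup s : Subobject X) : C) ⟶ Y)
    (hg : ∀ (a : Subobject X) (ha : a ∈ s), Mono (Subobject.ofLE a (sSup s) (le_sSup ha) ≫ g)) :
    Mono g := by
  let J := Shrink.{v} s
  let _ : SmallCategory J := Preorder.smallCategory J
  have : Nonempty J := ⟨equivShrink s ⟨_, hne.some_mem⟩⟩
  have : IsDirectedOrder J := ⟨fun x y => by
    obtain ⟨c, hc, h1, h2⟩ := hs _ ((equivShrink s).symm x).2 _ ((equivShrink s).symm y).2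
    refine ⟨equivShrink s ⟨c, hc⟩, ?_, ?_⟩ <;>
    · rw [← (orderIsoShrink s).symm.le_iff_le]
      simpa [← Subtype.coe_le_coe]⟩
  have hmono : Monotone fun j : J => (((equivShrink s).symm j : s) : Subobject X) :=
    fun x y h => h
  let T : J ⥤ MonoOver X := hmono.functor ⋙ Subobject.representative
  let G : J ⥤ C := T ⋙ MonoOver.forget _ ⋙ Over.forget _
  let c : Cocone G := colimit.cocone G
  let hc : IsColimit c := colimit.isColimit G
  let f : c.pt ⟶ X := hc.desc (Cocone.mk X
    { app j := (T.obj j).obj.hom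
      naturality {j j'} g := by simp [G, MonoOver.forget] })
  have hf (j : J) : c.ι.app j ≫ f = (T.obj j).obj.hom := hc.fac _ j
  have := IsGrothendieckAbelian.mono_of_isColimit_monoOver T hc f hf
  have hsup : Subobject.mk f = sSup s := by
    rw [IsGrothendieckAbelian.subobjectMk_of_isColimit_eq_iSup T hc f hf, sSup_eq_iSup']
    refine (equivShrink s).symm.iSup_congr fun j => ?_
    exact (Subobject.mk_arrow _).symm
  let φ : c.pt ⟶ ((sSup s : Subobject X) : C) :=
    (Subobject.underlyingIso f).inv ≫ Subobject.ofLE _ _ hsup.le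
  have hφ : φ ≫ (sSup s).arrow = f := by simp [φ]
  have : IsIso φ := by
    have : IsIso (Subobject.ofLE _ _ hsup.le) :=
      ⟨Subobject.ofLE _ _ hsup.ge, by simp, by simp⟩
    infer_instance
  have key (a : Subobject X) (ha : a ∈ s) (k : (a : C) ⟶ c.pt) (hk : k ≫ f = a.arrow) :
      Mono (k ≫ φ ≫ g) := by
    have e : k ≫ φ = Subobject.ofLE a (sSup s) (le_sSup ha) := by
      rw [← cancel_mono (sSup s).arrow, Category.assoc, hφ, hk, Subobject.ofLE_arrow]
    rw [← Category.assoc, e]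
    exact hg a ha
  let τ : G ⟶ (Functor.const J).obj Y :=
    { app j := c.ι.app j ≫ φ ≫ g
      naturality j j' h := (c.w_assoc h _).trans (Category.comp_id _).symm }
  have : ∀ j, Mono (τ.app j) := fun j => key _ ((equivShrink s).symm j).2 (c.ι.app j) (hf j)
  have := NatTrans.mono_of_mono_app τ
  have : Mono (φ ≫ g) := colim.map_mono' τ hc (isColimitConstCocone J Y) (φ ≫ g)
    (fun j => (Category.comp_id _).symm)
  have e : g = inv φ ≫ φ ≫ g := by simp
  rw [e]
  infer_instance

/-- Every subobject `L` of an injective object `I` has an injective hull which is a direct summand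
of `I`. -/
lemma exists_hull {L I : C} [Injective I] (l : L ⟶ I) [Mono l] :
    ∃ (F : C) (i : L ⟶ F) (e : F ⟶ I) (r : I ⟶ F), IsEssential i ∧ i ≫ e = l ∧ e ≫ r = 𝟙 F := by
  -- a maximal essential extension `F` of `L` inside `I`
  obtain ⟨F, -, hF⟩ := zorn_le_nonempty₀
    {F : Subobject I | ∃ i : L ⟶ (F : C), i ≫ F.arrow = l ∧ IsEssential i} (by
      intro s hs hch y hy
      obtain ⟨i, hi, hie⟩ := hs hy
      refine ⟨sSup s, ⟨i ≫ Subobject.ofLE y _ (le_sSup hy), by simpa, ?_, ?_⟩,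
        fun z hz => le_sSup hz⟩
      · have := hie.mono
        exact mono_comp _ _
      · intro Y g hg
        refine mono_of_directed_sSup s ⟨y, hy⟩ hch.directedOn g fun a ha => ?_
        obtain ⟨j, hj, hje⟩ := hs ha
        refine hje.mono_of_mono_comp _ ?_
        have e : i ≫ Subobject.ofLE y _ (le_sSup hy) = j ≫ Subobject.ofLE a _ (le_sSup ha) := by
          rw [← cancel_mono (sSup s).arrow]
          simp [hi, hj]
        rw [e] at hg
        simpa using hg) (Subobject.mk l)
    ⟨(Subobject.underlyingIso l).inv, by simp, isEssential_of_isIso _⟩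
  obtain ⟨⟨i, hi, hie⟩, hFmax⟩ := hF
  -- a subobject `D` of `I` maximal among those meeting `L` trivially
  obtain ⟨D, -, hD⟩ := zorn_le_nonempty₀
    {D : Subobject I | Mono (D.arrow ≫ cokernel.π l)} (by
      intro s hs hch y hy
      refine ⟨sSup s, ?_, fun z hz => le_sSup hz⟩
      refine mono_of_directed_sSup s ⟨y, hy⟩ hch.directedOn _ fun a ha => ?_
      have : Mono (a.arrow ≫ cokernel.π l) := hs ha
      simpa using this) ⊥ (by
      rw [Set.mem_ofPred_eq]
      refine Preadditive.mono_of_cancel_zero _ fun g _ => ?_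
      exact ((isZero_zero C).of_iso Subobject.botCoeIsoZero).eq_of_tgt _ _)
  obtain ⟨hDm, hDmax⟩ := hD
  rw [Set.mem_ofPred_eq] at hDm
  -- `L` is essential in `I / D`: a subobject of `I` above `D` meeting `L` trivially equals `D`
  have hq : IsEssential (l ≫ cokernel.π D.arrow) := by
    constructor
    · refine Preadditive.mono_of_cancel_zero _ fun g hg => ?_
      rw [← Category.assoc] at hg
      have h1 := Abelian.monoLift_comp D.arrow (g ≫ l) hg
      have h2 : Abelian.monoLift D.arrow (g ≫ l) hg = 0 := by
        rw [← cancel_mono (D.arrow ≫ cokernel.π l), ← Category.assoc, h1]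
        simp
      rw [h2, zero_comp] at h1
      rw [← cancel_mono l, ← h1, zero_comp]
    · intro Y g hg
      have hle : D ≤ kernelSubobject (cokernel.π D.arrow ≫ g) :=
        le_kernelSubobject _ _ (by simp)
      have hmem : Mono ((kernelSubobject (cokernel.π D.arrow ≫ g)).arrow ≫ cokernel.π l) := by
        refine Preadditive.mono_of_cancel_zero _ fun k hk => ?_
        rw [← Category.assoc] at hk
        have h1 := Abelian.monoLift_comp l _ hk
        have h2 : Abelian.monoLift l _ hk = 0 := by
          rw [← cancel_mono ((l ≫ cokernel.π D.arrow) ≫ g)]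
          simp only [Category.assoc, zero_comp]
          rw [← Category.assoc, h1, Category.assoc, kernelSubobject_arrow_comp, comp_zero]
        rw [h2, zero_comp] at h1
        rw [← cancel_mono (kernelSubobject _).arrow, ← h1, zero_comp]
      have hge := hDmax hmem hle
      refine Preadditive.mono_of_cancel_zero _ fun {P} k hk => ?_
      have h3 : pullback.fst (cokernel.π D.arrow) k ≫ cokernel.π D.arrow ≫ g = 0 := by
        rw [← Category.assoc, pullback.condition, Category.assoc, hk, comp_zero]
      have h4 : D.Factors (pullback.fst (cokernel.π D.arrow) k) :=
        Subobject.factors_of_le _ hge ((kernelSubobject_factors_iff _ _).2 h3)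
      rw [← cancel_epi (pullback.snd (cokernel.π D.arrow) k), ← pullback.condition,
        ← Subobject.factorThru_arrow _ _ h4, Category.assoc, cokernel.condition]
      simp
  have hπ : i ≫ F.arrow ≫ cokernel.π D.arrow = l ≫ cokernel.π D.arrow := by
    rw [← Category.assoc, hi]
  have : Mono (F.arrow ≫ cokernel.π D.arrow) := hie.mono_of_mono_comp _ (by rw [hπ]; exact hq.mono)
  -- extend the inclusion of `F` to `I / D`; the image is an essential extension of `L`
  let h : cokernel D.arrow ⟶ I := Injective.factorThru F.arrow (F.arrow ≫ cokernel.π D.arrow)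
  have hh : (F.arrow ≫ cokernel.π D.arrow) ≫ h = F.arrow := Injective.comp_factorThru _ _
  have hlh : (l ≫ cokernel.π D.arrow) ≫ h = l := by
    rw [← hπ, Category.assoc, hh, hi]
  have : Mono h := hq.mono_of_mono_comp h (by rw [hlh]; infer_instance)
  have hle : F ≤ Subobject.mk h := Subobject.le_mk_of_comm _ hh
  have hge : Subobject.mk h ≤ F := hFmax
    ⟨(l ≫ cokernel.π D.arrow) ≫ (Subobject.underlyingIso h).inv, by simpa using hlh,
      hq.comp (isEssential_of_isIso _)⟩ hle
  refine ⟨F, i, F.arrow, cokernel.π D.arrow ≫ (Subobject.underlyingIso h).inv ≫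
    Subobject.ofLE _ _ hge, hie, hi, ?_⟩
  rw [← cancel_mono F.arrow]
  simpa using hh

/-- A nonzero subobject of an indecomposable injective object is essential. -/
lemma isEssential_of_indecomposable {L I : C} [Injective I] (hI : Indecomposable I) (l : L ⟶ I)
    [Mono l] (hL : ¬ IsZero L) : IsEssential l := by
  obtain ⟨F, i, e, r, hi, hl, her⟩ := exists_hull l
  have := hi.mono
  have := isIso_of_retraction hI (fun hz => hL (hz.of_mono i)) e r her
  rw [← hl]
  exact hi.comp (isEssential_of_isIso e)

/-- An object all of whose nonzero subobjects are essential embeds into an indecomposable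
injective object. -/
lemma exists_mono_indecomposable_injective {L : C} (hL : ¬ IsZero L)
    (h : ∀ {B : C} (p : B ⟶ L), Mono p → ¬ IsZero B → IsEssential p) :
    ∃ (F : C) (i : L ⟶ F), Injective F ∧ Indecomposable F ∧ Mono i := by
  obtain ⟨F, i, e, r, hi, -, her⟩ := exists_hull (Injective.ι L)
  have := hi.mono
  have hF : Injective F := Retract.injective ⟨e, r, her⟩
  refine ⟨F, i, hF, ⟨fun hz => hL (hz.of_mono i), fun Y Z φ => ?_⟩, hi.mono⟩
  by_contra! hYZ
  obtain ⟨B, p, q, hp, hq, hB, hpq⟩ := hi.exists_common (biprod.inl ≫ φ.inv) hYZ.1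
  have hfst : Mono (φ.hom ≫ biprod.fst) := by
    refine ((h p hp hB).comp hi).mono_of_mono_comp _ ?_
    rw [hpq]
    simpa using hq
  refine hYZ.2 (isZero_of_eq_zero_of_mono (biprod.inr ≫ φ.inv) ?_)
  rw [← cancel_mono (φ.hom ≫ biprod.fst)]
  simp

end Hull

/-! ### Dimension and critical objects -/

section Dimension

variable {C : Type u} [Category.{v} C] [Abelian C]

namespace DimensionFunction

variable (δ : DimensionFunction.{t} C)

lemma dim_eq_max_cokernel {A B : C} (f : A ⟶ B) [Mono f] :
    δ.dim B = max (δ.dim A) (δ.dim (cokernel f)) :=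
  δ.dim_shortExact (ShortComplex.mk f (cokernel.π f) (cokernel.condition f))
    { exact := ShortComplex.exact_cokernel f
      mono_f := ‹_›
      epi_g := inferInstanceAs (Epi (cokernel.π f)) }

lemma dim_le_of_mono {A B : C} (f : A ⟶ B) [Mono f] : δ.dim A ≤ δ.dim B := by
  rw [δ.dim_eq_max_cokernel f]
  exact le_max_left _ _

lemma dim_le_of_epi {A B : C} (f : A ⟶ B) [Epi f] : δ.dim B ≤ δ.dim A := by
  rw [δ.dim_shortExact (ShortComplex.mk (kernel.ι f) f (kernel.condition f))
    { exact := ShortComplex.exact_kernel f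
      mono_f := inferInstanceAs (Mono (kernel.ι f))
      epi_g := ‹_› }]
  exact le_max_right _ _

lemma dim_le_dim_cokernel {A B Y : C} (f : A ⟶ B) (g : B ⟶ Y) [Epi g] (w : f ≫ g = 0) :
    δ.dim Y ≤ δ.dim (cokernel f) :=
  have : Epi (cokernel.desc f g w) := epi_of_epi_fac (cokernel.π_desc f g w)
  δ.dim_le_of_epi (cokernel.desc f g w)

variable {δ} in
/-- The dimension `α` of the category is the dimension of some noetherian object: it is the supremum
of the dimensions of the noetherian objects, and when `α` is not a limit this forces it to be
attained. -/
lemma exists_noetherian_dim_eq {α : Ordinal.{t}} (hα : δ.SpaceDimEq α)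
    (hlim : Order.IsSuccLimit α → ∃ N : C, IsNoetherianObject N ∧ δ.dim N = α) :
    ∃ N : C, IsNoetherianObject N ∧ δ.dim N = α := by
  by_contra! hno
  -- any bound for the dimensions of the noetherian objects is at least `α`
  have hbound (b : WithBot Ordinal.{t}) (hb : ∀ N : C, IsNoetherianObject N → δ.dim N ≤ b) :
      (α : WithBot Ordinal.{t}) ≤ b := by
    refine hα.2 ?_
    rintro _ ⟨N, rfl⟩
    refine (δ.dim_isLUB N).2 ?_
    rintro _ ⟨N', hN', rfl⟩
    exact hb _ hN'
  have hlt (N : C) (hN : IsNoetherianObject N) : δ.dim N < α :=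
    lt_of_le_of_ne (hα.1 ⟨N, rfl⟩) (hno N hN)
  rcases Ordinal.zero_or_succ_or_isSuccLimit α with rfl | ⟨γ, rfl⟩ | h
  · refine (WithBot.bot_lt_coe (0 : Ordinal.{t})).not_ge (hbound ⊥ fun N hN => ?_)
    exact (WithBot.lt_coe_bot.1 (Ordinal.bot_eq_zero ▸ hlt N hN)).le
  · refine (WithBot.coe_lt_coe.2 (Order.lt_succ γ)).not_ge (hbound γ fun N hN => ?_)
    have h := hlt N hN
    generalize δ.dim N = d at h
    cases d with
    | bot => exact bot_le
    | coe d => exact WithBot.coe_le_coe.2 (Order.lt_succ_iff.1 (WithBot.coe_lt_coe.1 h))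
  · obtain ⟨N, h1, h2⟩ := hlim h
    exact hno N h1 h2

namespace IsCritical

variable {δ} {α : Ordinal.{t}} {M : C}

lemma of_iso (h : δ.IsCritical α M) {M' : C} (e : M ≅ M') : δ.IsCritical α M' := by
  refine ⟨(le_antisymm (δ.dim_le_of_epi e.hom) (δ.dim_le_of_mono e.hom)).trans h.1, fun N hN => ?_⟩
  have hne : Subobject.mk (N.arrow ≫ e.inv) ≠ ⊥ := fun he => hN (by
    rw [← Subobject.mk_arrow N, Subobject.mk_eq_bot_iff_zero]
    rw [Subobject.mk_eq_bot_iff_zero] at he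
    rw [← cancel_mono e.inv, he, zero_comp])
  have hz : (Subobject.mk (N.arrow ≫ e.inv)).arrow ≫ e.hom ≫ cokernel.π N.arrow = 0 := by
    rw [← Subobject.underlyingIso_hom_comp_eq_mk]
    simp only [Category.assoc, Iso.inv_hom_id_assoc, cokernel.condition, comp_zero]
  exact lt_of_le_of_lt (δ.dim_le_dim_cokernel _ _ hz) (h.2 _ hne)

lemma not_isZero (h : δ.IsCritical α M) : ¬ IsZero M := fun hz => by
  have := (δ.dim_eq_bot_iff M).2 hz
  rw [h.1] at this
  exact WithBot.coe_ne_bot this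

lemma dim_cokernel_lt (h : δ.IsCritical α M) {A : C} (f : A ⟶ M) [Mono f] (hA : ¬ IsZero A) :
    δ.dim (cokernel f) < α := by
  have hne : Subobject.mk f ≠ ⊥ := fun he =>
    hA (isZero_of_eq_zero_of_mono f (Subobject.mk_eq_bot_iff_zero.1 he))
  have hz : (Subobject.mk f).arrow ≫ cokernel.π f = 0 := by
    rw [← Subobject.underlyingIso_hom_comp_eq_mk, Category.assoc, cokernel.condition, comp_zero]
  exact lt_of_le_of_lt (δ.dim_le_dim_cokernel _ _ hz) (h.2 _ hne)

/-- A nonzero subobject of a critical object has full dimension. -/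
lemma dim_eq_of_mono (h : δ.IsCritical α M) {A : C} (f : A ⟶ M) [Mono f] (hA : ¬ IsZero A) :
    δ.dim A = α := by
  have h1 := δ.dim_eq_max_cokernel f
  rw [h.1] at h1
  refine le_antisymm (h1 ▸ le_max_left _ _) ?_
  rcases le_max_iff.1 h1.le with h2 | h2
  · exact h2
  · exact absurd (h.dim_cokernel_lt f hA) h2.not_gt

/-- A morphism out of a critical object that is not a monomorphism has small image. -/
lemma dim_image_lt (h : δ.IsCritical α M) {X : C} (f : M ⟶ X) (hf : ¬ Mono f) :
    δ.dim (image f) < α := by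
  have hz : kernel.ι f ≫ factorThruImage f = 0 := by
    rw [← cancel_mono (image.ι f)]
    simp
  exact lt_of_le_of_lt (δ.dim_le_dim_cokernel _ _ hz)
    (h.dim_cokernel_lt _ (not_isZero_kernel_of_not_mono f hf))

/-- Critical objects are uniform: all their nonzero subobjects are essential. -/
lemma isEssential (h : δ.IsCritical α M) {B : C} (p : B ⟶ M) (hp : Mono p) (hB : ¬ IsZero B) :
    IsEssential p where
  mono := hp
  mono_of_mono_comp g hg := by
    by_contra hng
    have : Mono (p ≫ factorThruImage g) := by
      have : Mono ((p ≫ factorThruImage g) ≫ image.ι g) := by simpa using hg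
      exact mono_of_mono _ (image.ι g)
    have h1 := δ.dim_le_of_mono (p ≫ factorThruImage g)
    rw [h.dim_eq_of_mono p hB] at h1
    exact absurd (h.dim_image_lt g hng) h1.not_gt

end IsCritical

variable {δ} in
/-- A noetherian object of dimension `α` has an `α`-critical quotient: divide by a maximal
subobject whose quotient still has dimension `α`. -/
lemma exists_isCritical_quotient {α : Ordinal.{t}} {N : C} [IsNoetherianObject N]
    (hN : δ.dim N = α) : ∃ (M : C) (f : N ⟶ M), Epi f ∧ δ.IsCritical α M := by
  obtain ⟨A, ⟨M, f, hf, hA, hM⟩, hmax⟩ := wellFounded_gt.has_min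
    {A : Subobject N | ∃ (Y : C) (f : N ⟶ Y), Epi f ∧ kernelSubobject f = A ∧ δ.dim Y = α}
    ⟨_, N, 𝟙 N, inferInstance, rfl, hN⟩
  refine ⟨M, f, hf, hM, fun K hK => lt_of_le_of_ne (hM ▸ δ.dim_le_of_epi (cokernel.π K.arrow)) ?_⟩
  intro hdim
  have hle : kernelSubobject f ≤ kernelSubobject (f ≫ cokernel.π K.arrow) :=
    kernelSubobject_comp_le f _
  have hnlt := hmax _ ⟨_, f ≫ cokernel.π K.arrow, epi_comp _ _, rfl, hdim⟩
  rw [← hA] at hnlt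
  have heq : kernelSubobject (f ≫ cokernel.π K.arrow) ≤ kernelSubobject f :=
    (eq_of_le_of_not_lt hle hnlt).ge
  have h1 : pullback.fst f K.arrow ≫ f ≫ cokernel.π K.arrow = 0 := by
    rw [← Category.assoc, pullback.condition, Category.assoc, cokernel.condition, comp_zero]
  have h2 : pullback.fst f K.arrow ≫ f = 0 :=
    (kernelSubobject_factors_iff _ _).1
      (Subobject.factors_of_le _ heq ((kernelSubobject_factors_iff _ _).2 h1))
  refine hK ?_
  rw [← Subobject.mk_arrow K, Subobject.mk_eq_bot_iff_zero, ← cancel_epi (pullback.snd f K.arrow),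
    ← pullback.condition, h2, comp_zero]

/-- Every nonzero object has a critical subobject. Among the nonzero noetherian subobjects take one
of least dimension `β`; if neither it nor any of its subobjects were `β`-critical, there would be a
descending chain with all factors of dimension `β`. -/
lemma exists_isCritical_mono {N : C} (hN : ¬ IsZero N) :
    ∃ (β : Ordinal.{t}) (L : C) (i : L ⟶ N), Mono i ∧ δ.IsCritical β L := by
  have hex : ∃ N' : Subobject N, IsNoetherianObject (N' : C) ∧ δ.dim (N' : C) ≠ ⊥ := by
    by_contra! h
    refine hN ((δ.dim_eq_bot_iff N).1 (le_bot_iff.1 ((isLUB_le_iff (δ.dim_isLUB N)).2 ?_)))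
    rintro _ ⟨N', h1, rfl⟩
    exact (h N' h1).le
  obtain ⟨N₁, hN₁, hN₁'⟩ := hex
  obtain ⟨b, ⟨hb, L, i, hi, hL, rfl⟩, hmin⟩ := wellFounded_lt.has_min
    {d : WithBot Ordinal.{t} | d ≠ ⊥ ∧ ∃ (L : C) (i : L ⟶ N), Mono i ∧ IsNoetherianObject L ∧
      δ.dim L = d} ⟨_, hN₁', N₁, N₁.arrow, inferInstance, hN₁, rfl⟩
  obtain ⟨β, hβ⟩ := WithBot.ne_bot_iff_exists.1 hb
  have hsub (A : Subobject L) (hA : A ≠ ⊥) : δ.dim (A : C) = β := by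
    rw [hβ]
    refine eq_of_le_of_not_lt (δ.dim_le_of_mono A.arrow) (hmin _ ⟨fun h => hA ?_, A, A.arrow ≫ i,
      mono_comp _ _, isNoetherianObject_of_mono A.arrow, rfl⟩)
    rw [← Subobject.mk_arrow A, Subobject.mk_eq_bot_iff_zero]
    exact ((δ.dim_eq_bot_iff _).1 h).eq_of_src _ _
  refine ⟨β, ?_⟩
  by_contra! hno
  have hstep (A : {A : Subobject L // A ≠ ⊥}) : ∃ B : {A : Subobject L // A ≠ ⊥},
      ∃ h : B.1 < A.1, ¬ δ.dim (subquot B.1 A.1 h.le) < β := by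
    have h := hno A.1 (A.1.arrow ≫ i) (mono_comp _ _)
    rw [IsCritical, not_and] at h
    have h' := h (hsub A.1 A.2)
    push Not at h'
    obtain ⟨K, hK, hKdim⟩ := h'
    let B := Subobject.mk (K.arrow ≫ A.1.arrow)
    have hBne : B ≠ ⊥ := fun h => hK (by
      rw [← Subobject.mk_arrow K, Subobject.mk_eq_bot_iff_zero]
      rw [Subobject.mk_eq_bot_iff_zero] at h
      rw [← cancel_mono A.1.arrow, h, zero_comp])
    have hBA : B ≤ A.1 := Subobject.mk_le_of_comm K.arrow rfl
    have hfac : Subobject.ofLE B A.1 hBA =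
        (Subobject.underlyingIso (K.arrow ≫ A.1.arrow)).hom ≫ K.arrow := by
      rw [← cancel_mono A.1.arrow]
      simp [B]
    have hdim : ¬ δ.dim (subquot B A.1 hBA) < β := by
      refine not_lt.2 (hKdim.trans ?_)
      have hz : Subobject.ofLE B A.1 hBA ≫ cokernel.π K.arrow = 0 := by
        rw [hfac, Category.assoc, cokernel.condition, comp_zero]
      exact δ.dim_le_dim_cokernel _ _ hz
    refine ⟨⟨B, hBne⟩, lt_of_le_of_ne hBA fun heq => hdim ?_, hdim⟩
    have hz : IsZero (subquot B A.1 hBA) := by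
      have : IsIso (Subobject.ofLE B A.1 hBA) := ⟨Subobject.ofLE _ _ heq.ge, by simp, by simp⟩
      exact isZero_cokernel_of_epi _
    rw [(δ.dim_eq_bot_iff _).2 hz]
    exact WithBot.bot_lt_coe β
  -- iterating `hstep` from `⊤` gives a chain in which no factor has dimension less than `β`
  choose next hlt hnext using hstep
  have htop : (⊤ : Subobject L) ≠ ⊥ := fun h => hb ((δ.dim_eq_bot_iff L).2
    (isZero_of_eq_zero_of_mono (𝟙 L) (by rwa [Subobject.top_eq_id, Subobject.mk_eq_bot_iff_zero]
      at h)))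
  let F : ℕ → {A : Subobject L // A ≠ ⊥} := fun n => next^[n] ⟨⊤, htop⟩
  have hF (n : ℕ) : F (n + 1) = next (F n) := Function.iterate_succ_apply' next n _
  have hanti : StrictAnti fun n => (F n).1 := strictAnti_nat_of_succ_lt fun n => by
    rw [hF]
    exact hlt _
  have hfin := δ.finitelyPartitive L hL (fun n => (F n).1) hanti rfl
  refine Set.infinite_univ (hfin.subset fun n _ => ?_)
  have key (B : {A : Subobject L // A ≠ ⊥}) (hB : B = next (F n)) (h : B.1 ≤ (F n).1) :
      ¬ δ.dim (subquot B.1 (F n).1 h) < δ.dim L := by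
    subst hB
    rw [← hβ]
    exact hnext _
  exact key _ (hF n) _

end DimensionFunction

end Dimension

/-! ### Saturation of weakly closed subcategories -/

section Saturation

variable {C : Type u} [Category.{v} C] [Abelian C]

/-- If `k` is a kernel of `f`, then `f` induces a monomorphism on the cokernel of `k`. -/
lemma mono_cokernel_desc_of_lifts {A B Y : C} (k : A ⟶ B) (f : B ⟶ Y) (w : k ≫ f = 0) [Mono k]
    (h : ∀ {P : C} (g : P ⟶ B), g ≫ f = 0 → ∃ l : P ⟶ A, l ≫ k = g) :
    Mono (cokernel.desc k f w) := by
  have hex : (ShortComplex.mk k f w).Exact := by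
    refine ShortComplex.exact_of_f_is_kernel _
      (KernelFork.IsLimit.ofι' k w fun g hg => ⟨(h g hg).choose, (h g hg).choose_spec⟩)
  exact hex.mono_cokernelDesc

lemma factors_iff_comp_cokernel_eq_zero {N P : C} (A : Subobject N) (g : P ⟶ N) :
    A.Factors g ↔ g ≫ cokernel.π A.arrow = 0 := by
  refine ⟨fun h => ?_, fun h => ?_⟩
  · rw [← Subobject.factorThru_arrow _ _ h, Category.assoc, cokernel.condition, comp_zero]
  · rw [← Abelian.monoLift_comp A.arrow g h]
    exact Subobject.factors_comp_arrow _

variable [IsGrothendieckAbelian.{v} C] {Z : ObjectProperty C}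

/-- A weakly closed subcategory is closed under sums of subobjects. -/
lemma IsWeaklyClosed.prop_sSup (hZ : IsWeaklyClosed Z) {X : C} (s : Set (Subobject X))
    (hs : ∀ a ∈ s, Z (a : C)) : Z ((sSup s : Subobject X) : C) := by
  have := hZ.subobjects
  have := hZ.quotients
  have := hZ.directSums (Shrink.{v} s)
  let G : Shrink.{v} s → C := fun j => (((equivShrink s).symm j).1 : C)
  have hG : Z (∐ G) :=
    Z.prop_of_isColimit (colimit.isColimit _) fun j => hs _ ((equivShrink s).symm j.as).2
  let f : ∐ G ⟶ X := Sigma.desc fun j => ((equivShrink s).symm j).1.arrow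
  have him : Z (image f) := Z.prop_of_epi (factorThruImage f) hG
  have hle : sSup s ≤ Subobject.mk (image.ι f) := by
    refine sSup_le fun a ha => ?_
    have key (j : Shrink.{v} s) : ((equivShrink s).symm j).1 ≤ Subobject.mk (image.ι f) :=
      Subobject.le_mk_of_comm (Sigma.ι G j ≫ factorThruImage f) (by simp [f, G])
    simpa using key (equivShrink s ⟨a, ha⟩)
  exact Z.prop_of_mono (Subobject.ofLE _ _ hle ≫ (Subobject.underlyingIso _).hom) him

/-- The largest subobject of `X` lying in a weakly closed subcategory `Z`. -/
noncomputable def torsion (Z : ObjectProperty C) (X : C) : Subobject X :=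
  sSup {A : Subobject X | Z (A : C)}

/-- The preimage in `N` of the largest subobject of `N / A` lying in `Z`. -/
noncomputable def torsionStep (Z : ObjectProperty C) {N : C} (A : Subobject N) : Subobject N :=
  (Subobject.pullback (cokernel.π A.arrow)).obj (torsion Z (cokernel A.arrow))

lemma factors_torsionStep_iff {N P : C} (A : Subobject N) (g : P ⟶ N) :
    (torsionStep Z A).Factors g ↔
      (torsion Z (cokernel A.arrow)).Factors (g ≫ cokernel.π A.arrow) :=
  pullback_factors_iff _ _ _

lemma le_torsionStep {N : C} (A : Subobject N) : A ≤ torsionStep Z A := by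
  have h : (torsionStep Z A).Factors A.arrow := by
    rw [factors_torsionStep_iff, cokernel.condition]
    exact Subobject.factors_zero
  exact Subobject.le_of_factors h

lemma IsWeaklyClosed.subquot_torsionStep (hZ : IsWeaklyClosed Z) {N : C} (A : Subobject N)
    (h : A ≤ torsionStep Z A) : Z (subquot A (torsionStep Z A) h) := by
  have := hZ.subobjects
  have hf := (factors_torsionStep_iff (Z := Z) A (torsionStep Z A).arrow).1
    (Subobject.factors_self _)
  let f := Subobject.factorThru _ _ hf
  have hfa : f ≫ (torsion Z (cokernel A.arrow)).arrow =
      (torsionStep Z A).arrow ≫ cokernel.π A.arrow := Subobject.factorThru_arrow _ _ hf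
  have w : Subobject.ofLE A _ h ≫ f = 0 := by
    rw [← cancel_mono (torsion Z (cokernel A.arrow)).arrow, Category.assoc, hfa]
    simp
  have : Mono (cokernel.desc (Subobject.ofLE A _ h) f w) := by
    refine mono_cokernel_desc_of_lifts _ _ _ fun g hg => ?_
    have hg' : A.Factors (g ≫ (torsionStep Z A).arrow) := by
      rw [factors_iff_comp_cokernel_eq_zero, Category.assoc, ← hfa, ← Category.assoc, hg, zero_comp]
    refine ⟨Subobject.factorThru _ _ hg', ?_⟩
    rw [← cancel_mono (torsionStep Z A).arrow]
    simp
  change Z (cokernel (Subobject.ofLE A _ h))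
  exact Z.prop_of_mono (cokernel.desc (Subobject.ofLE A _ h) f w)
    (hZ.prop_sSup _ fun _ h => h)

/-- In a locally noetherian category, if every nonzero object has a nonzero subobject in a weakly
closed `Z`, then every object is supported at `Z`: iterating the largest subobject in `Z` exhausts
the object, because the kernels of the induced maps out of a noetherian generator stabilize. -/
lemma IsWeaklyClosed.saturation_of_exists (hZ : IsWeaklyClosed Z) (hC : IsLocallyNoetherian C)
    (h : ∀ X : C, ¬ IsZero X → ∃ (B : C) (b : B ⟶ X), Mono b ∧ ¬ IsZero B ∧ Z B) (N : C) :
    saturation Z N := by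
  let F : ℕ → Subobject N := fun n => (torsionStep Z)^[n] ⊥
  have hF (n : ℕ) : F (n + 1) = torsionStep Z (F n) := Function.iterate_succ_apply' _ n _
  have hmono : Monotone F := monotone_nat_of_le_succ fun n => by
    rw [hF]
    exact le_torsionStep _
  refine ⟨F, hmono, rfl, ⟨fun _ _ => le_top, fun U hU => ?_⟩, fun n => ?_⟩
  · obtain ⟨ι, G, hG, hsep⟩ := hC
    have hfac {i : ι} (g : G i ⟶ N) : ∃ n, (F n).Factors g := by
      have := hG i
      let K : ℕ →o Subobject (G i) := ⟨fun n => (Subobject.pullback g).obj (F n),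
        fun m n hmn => (Subobject.pullback g).monotone (hmono hmn)⟩
      obtain ⟨n, hn⟩ := monotone_chain_condition_of_isNoetherianObject K
      have hn' : K (n + 1) = K n := (hn (n + 1) (Nat.le_succ n)).symm
      refine ⟨n, ?_⟩
      rw [factors_iff_comp_cokernel_eq_zero]
      by_contra hne
      obtain ⟨k, hk⟩ : ∃ k, k = g ≫ cokernel.π (F n).arrow := ⟨_, rfl⟩
      rw [← hk] at hne
      obtain ⟨B, b, hb, hB, hZB⟩ := h _ (not_isZero_image_of_ne_zero k hne)
      have hle : Subobject.mk (b ≫ image.ι k) ≤ torsion Z (cokernel (F n).arrow) := by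
        have := hZ.subobjects
        exact le_sSup (Z.prop_of_mono (Subobject.underlyingIso _).hom hZB)
      have hcomm : pullback.fst (factorThruImage k) b ≫ k =
          pullback.snd (factorThruImage k) b ≫ b ≫ image.ι k := by
        rw [← Category.assoc, ← pullback.condition, Category.assoc, image.fac]
      have h1 : (F (n + 1)).Factors (pullback.fst (factorThruImage k) b ≫ g) := by
        rw [hF, factors_torsionStep_iff, Category.assoc, ← hk, hcomm]
        exact Subobject.factors_of_le _ hle
          (Subobject.factors_of_factors_right _ (Subobject.mk_factors_self _))
      have h2 : (F n).Factors (pullback.fst (factorThruImage k) b ≫ g) := by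
        have : (K (n + 1)).Factors (pullback.fst (factorThruImage k) b) :=
          (pullback_factors_iff _ _ _).2 h1
        rw [hn'] at this
        exact (pullback_factors_iff _ _ _).1 this
      rw [factors_iff_comp_cokernel_eq_zero, Category.assoc, ← hk, hcomm] at h2
      refine hB (isZero_of_eq_zero_of_mono (b ≫ image.ι k) ?_)
      rw [← cancel_epi (pullback.snd (factorThruImage k) b), h2, comp_zero]
    have hU0 : cokernel.π U.arrow = 0 := by
      refine hsep _ _ fun G' hG' g => ?_
      obtain ⟨i⟩ := hG'
      obtain ⟨n, hn⟩ := hfac g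
      rw [(factors_iff_comp_cokernel_eq_zero U g).1
        (Subobject.factors_of_le _ (hU ⟨n, rfl⟩) hn), comp_zero]
    have : Epi U.arrow := Preadditive.epi_of_cokernel_zero hU0
    have : IsIso U.arrow := isIso_of_mono_of_epi _
    exact (Subobject.eq_top_of_isIso_arrow U).ge
  · have key (B : Subobject N) (hB : B = torsionStep Z (F n)) (hle : F n ≤ B) :
        Z (subquot (F n) B hle) := by
      subst hB
      exact hZ.subquot_torsionStep _ _
    exact key _ (hF n) _

end Saturation

/-! ### Open points of the injective spectrum -/

section Spectrum

variable {C : Type u} [Category.{v} C] [Abelian C]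

lemma Inj.injective_E (x : Inj C) : Injective x.E := (Quotient.out x).2.1

lemma Inj.indecomposable_E (x : Inj C) : Indecomposable x.E := (Quotient.out x).2.2

lemma Inj.eq_of_iso {x y : Inj C} (e : x.E ≅ y.E) : x = y := by
  rw [← Quotient.out_eq x, ← Quotient.out_eq y]
  exact Quotient.sound ⟨e⟩

lemma Inj.exists_iso (F : C) [hF : Injective F] (hF' : Indecomposable F) :
    ∃ x : Inj C, Nonempty (x.E ≅ F) :=
  ⟨Quotient.mk (injSetoid C) ⟨F, hF, hF'⟩,
    Quotient.exact (s := injSetoid C) (Quotient.out_eq _)⟩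

/-- For injective `F`, the objects without nonzero morphisms to `F` form a weakly closed
subcategory. -/
lemma isWeaklyClosed_hom_eq_zero (F : C) [Injective F] :
    IsWeaklyClosed fun N : C => ∀ f : N ⟶ F, f = 0 where
  subobjects := ⟨fun i _ hY f => by
    rw [← Injective.comp_factorThru f i, hY (Injective.factorThru f i), comp_zero]⟩
  quotients := ⟨fun p _ hX f => by rw [← cancel_epi p, hX (p ≫ f), comp_zero]⟩
  directSums I := ⟨by
    rintro N ⟨h⟩ f
    exact h.isColimit.hom_ext fun j => (h.prop_diag_obj j _).trans comp_zero.symm⟩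

lemma isOpen_compl_V {Z : ObjectProperty C} (hZ : IsWeaklyClosed Z) : IsOpen (V Z)ᶜ :=
  TopologicalSpace.isOpen_generateFrom_of_mem ⟨Z, hZ, rfl⟩

lemma mem_V_of_mono {Z : ObjectProperty C} (hZ : IsWeaklyClosed Z) {x : Inj C} {B : C}
    (b : B ⟶ x.E) [Mono b] (hB : ¬ IsZero B) (h : Z B) : x ∈ V Z := by
  have := hZ.subobjects
  exact ⟨Subobject.mk b, fun he => hB (isZero_of_eq_zero_of_mono b
    (Subobject.mk_eq_bot_iff_zero.1 he)), Z.prop_of_mono (Subobject.underlyingIso b).hom h⟩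

lemma not_isZero_of_ne_bot {X : C} {A : Subobject X} (hA : A ≠ ⊥) : ¬ IsZero (A : C) := fun hz =>
  hA (by
    rw [← Subobject.mk_arrow A, Subobject.mk_eq_bot_iff_zero]
    exact hz.eq_of_src _ _)

variable [IsGrothendieckAbelian.{v} C]

/-- A critical object has an indecomposable injective hull, so it embeds into `E(x)` for some
point `x` of the injective spectrum. -/
lemma DimensionFunction.IsCritical.exists_mono_E {δ : DimensionFunction.{t} C} {β : Ordinal.{t}}
    {L : C} (hL : δ.IsCritical β L) : ∃ (x : Inj C) (i : L ⟶ x.E), Mono i := by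
  obtain ⟨F, i, hF, hF', hi⟩ := exists_mono_indecomposable_injective hL.not_isZero
    fun p hp hB => hL.isEssential p hp hB
  obtain ⟨x, ⟨e⟩⟩ := Inj.exists_iso F hF'
  exact ⟨x, i ≫ e.inv, mono_comp _ _⟩

/-- A point whose injective contains a critical object of the largest possible dimension is open:
it is the complement of `V(Z)` for `Z` the subcategory of objects without nonzero morphisms to
`E(x)`. Indeed, if `y` is outside `V(Z)`, a critical subobject of `E(y)` has a nonzero morphism to
`E(x)`. Since all nonzero subobjects of `E(x)` have the largest dimension, this morphism is a
monomorphism, and then `E(x)` and `E(y)` are hulls of the same object. -/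
lemma isOpen_singleton_of_isCritical (δ : DimensionFunction.{t} C) {α : Ordinal.{t}}
    (hα : ∀ N : C, δ.dim N ≤ α) {x : Inj C} {N : C} (n : N ⟶ x.E) [Mono n]
    (hN : δ.IsCritical α N) : IsOpen ({x} : Set (Inj C)) := by
  have := x.injective_E
  suffices h : ({x} : Set (Inj C)) = (V fun N : C => ∀ f : N ⟶ x.E, f = 0)ᶜ by
    rw [h]
    exact isOpen_compl_V (isWeaklyClosed_hom_eq_zero x.E)
  have hbig {A : C} (a : A ⟶ x.E) [Mono a] (hA : ¬ IsZero A) : (α : WithBot Ordinal) ≤ δ.dim A := by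
    obtain ⟨B, p, q, hp, hq, hB, -⟩ :=
      (isEssential_of_indecomposable x.indecomposable_E n hN.not_isZero).exists_common a hA
    rw [← hN.dim_eq_of_mono p hB]
    exact δ.dim_le_of_mono q
  ext y
  rw [Set.mem_singleton_iff, Set.mem_compl_iff]
  constructor
  · rintro rfl ⟨A, hA, h⟩
    exact not_isZero_of_ne_bot hA (isZero_of_eq_zero_of_mono _ (h A.arrow))
  · intro hy
    have := y.injective_E
    obtain ⟨β, L, i, hi, hL⟩ := δ.exists_isCritical_mono y.indecomposable_E.1
    have hex : ∃ f : L ⟶ x.E, f ≠ 0 := by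
      by_contra! h
      exact hy (mem_V_of_mono (isWeaklyClosed_hom_eq_zero x.E) i hL.not_isZero h)
    obtain ⟨f, hf⟩ := hex
    have him := hbig (image.ι f) (not_isZero_image_of_ne_zero f hf)
    have hfm : Mono f := by
      by_contra hfm
      exact absurd (him.trans_lt (hL.dim_image_lt f hfm)) (hL.1 ▸ hα L).not_gt
    obtain ⟨e⟩ := nonempty_iso_of_isEssential x.indecomposable_E
      (isEssential_of_indecomposable y.indecomposable_E i hL.not_isZero) f hL.not_isZero
    exact Inj.eq_of_iso e

end Spectrum

end NCSpace

/-! ### Irreducible spaces with a dimension function -/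

theorem mainTheorem1 (C : Type u) [Category.{v} C] [Abelian C] [IsGrothendieckAbelian.{v} C]
    (hC : NCSpace.IsLocallyNoetherian C) (δ : NCSpace.DimensionFunction.{t} C)
    (hirr : NCSpace.TopologicallyIrreducible C) (α : Ordinal.{t}) (hα : δ.SpaceDimEq α)
    (hlim : Order.IsSuccLimit α → ∃ N : C, IsNoetherianObject N ∧ δ.dim N = α) :
    (∃ M : C, δ.IsCritical α M ∧ ∀ N : C, NCSpace.saturation (NCSpace.sigma M) N) ∧
      ∃! x : NCSpace.Inj C, x ∈ δ.InjDim α := by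
  have hle (N : C) : δ.dim N ≤ α := hα.1 ⟨N, rfl⟩
  obtain ⟨N₀, hN₀, hdim₀⟩ := δ.exists_noetherian_dim_eq hα hlim
  obtain ⟨M, -, -, hM⟩ := NCSpace.DimensionFunction.exists_isCritical_quotient hdim₀
  obtain ⟨x, i, hi⟩ := hM.exists_mono_E
  have hx : IsOpen ({x} : Set (NCSpace.Inj C)) := NCSpace.isOpen_singleton_of_isCritical δ hle i hM
  have : IrreducibleSpace (NCSpace.Inj C) := hirr
  have hσ := NCSpace.sigma_isWeaklyClosed M
  -- `x` is an open, hence dense, point of the closed set `V(σ[M])`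
  have hV (y : NCSpace.Inj C) : y ∈ NCSpace.V (NCSpace.sigma M) := by
    by_contra hy
    obtain ⟨_, rfl, h⟩ := nonempty_preirreducible_inter hx (NCSpace.isOpen_compl_V hσ)
      ⟨x, rfl⟩ ⟨y, hy⟩
    exact h (NCSpace.mem_V_of_mono hσ i hM.not_isZero (NCSpace.sigma_self M))
  refine ⟨⟨M, hM, hσ.saturation_of_exists hC fun N hN => ?_⟩, x, ?_, ?_⟩
  · obtain ⟨β, L, l, hl, hL⟩ := δ.exists_isCritical_mono hN
    obtain ⟨y, j, hj⟩ := hL.exists_mono_E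
    obtain ⟨A, hA, hAσ⟩ := hV y
    have := y.injective_E
    obtain ⟨B, p, q, hp, hq, hB, -⟩ :=
      (NCSpace.isEssential_of_indecomposable y.indecomposable_E j hL.not_isZero).exists_common
        A.arrow (NCSpace.not_isZero_of_ne_bot hA)
    have := hσ.subobjects
    exact ⟨B, p ≫ l, mono_comp _ _, hB, (NCSpace.sigma M).prop_of_mono q hAσ⟩
  · exact ⟨Subobject.mk i, hM.of_iso (Subobject.underlyingIso i).symm⟩
  · rintro y ⟨N, hN⟩
    obtain ⟨_, rfl, h⟩ := nonempty_preirreducible_inter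
      (NCSpace.isOpen_singleton_of_isCritical δ hle N.arrow hN) hx ⟨y, rfl⟩ ⟨x, rfl⟩
    exact h
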